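/- Let $\mathbb N=\{1,2,\dots\}$, $\mathbb Z^*=\mathbb Z\setminus\{0\}$, and let $(k_n)_{n\in\mathbb Z^*}\subseteq\mathbb N$ be such that $(k_n)_{n\in\mathbb N}$ and $(k_{-n})_{n\in\mathbb N}$ are (weakly) increasing. A constant word is a map $w:\operatorname{dom}(w)\to\mathbb Z^*$, $n\mapsto w_n$, where $\operatorname{dom}(w)\subseteq\mathbb Z^*$ is finite and non-empty, with $w_n\in\{1,\dots,k_n\}$ for $n>0$ and $w_n\in\{-k_n,\dots,-1\}$ for $n<0$; the set of these words is $\widetilde L(\Sigma,\vec k)$. A variable word is defined in the same way, except that the values $w_n$ may also be a symbol $\upsilon$ (the variable). For words $w,u$ write $w<_{R_1}u$ if $\operatorname{dom}(u)=A_1\cup A_2$ with $A_1,A_2\ne\emptyset$ and $\max A_1<\min\operatorname{dom}(w)\le\max\operatorname{dom}(w)<\min A_2$; in that case $w\star u$ denotes the word with domain $\operatorname{dom}(w)\cup\operatorname{dom}(u)$ that extends both $w$ and $u$. Let $(S,+)$ be a commutative semigroup, let $y_{l,n}\in S$ for $l,n\in\mathbb Z^*$, and put $\varphi(w)=\sum_{n\in\operatorname{dom}(w)}y_{w_n,n}$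 for $w\in\widetilde L(\Sigma,\vec k)$. A family $(T^s)_{s\in S}$ of continuous self-maps of a topological space $X$ is called an $\widetilde L(\Sigma,\vec k)$-system of $S$ if $T^{\varphi(w_1)}T^{\varphi(w_2)}=T^{\varphi(w_1\star w_2)}$ whenever $w_1<_{R_1}w_2$ in $\widetilde L(\Sigma,\vec k)$. For a sequence $(a_n)$ in $S$, $FS[(a_n)_{n\ge n_0}]$ denotes the set of all sums $a_{n_1}+\dots+a_{n_\lambda}$ with $\lambda\ge1$ and $n_0\le n_1<\dots<n_\lambda$. **Theorem.** Let $X$ be a non-empty compact metric space and let $\{T_1^s\}_{s\in S},\dots,\{T_m^s\}_{s\in S}$ be $\widetilde L(\Sigma,\vec k)$-systems of $S$ consisting of homeomorphisms of $X$, all contained in a commutative group $G$ of homeomorphisms of $X$. Then there exist $x_0\in X$, variable words $w^{(1)}<_{R_1}w^{(2)}<_{R_1}\cdots$ and functions $s_n:\{1,\dots,k_n\}\times\{1,\dots,k_{-n}\}\to S$ ($n\in\mathbb N$) such that, with $$C_n^{\pm}=\{t\in\operatorname{dom}(w^{(n)}):w^{(n)}_t\ne\upsilon,\ \pm t>0\},\qquad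 C_n=C_n^-\cup C_n^+,\qquad V_n^{\pm}=\{t\in\operatorname{dom}(w^{(n)}):w^{(n)}_t=\upsilon,\ \pm t>0\},$$ the following hold for every $n\in\mathbb N$: the sets $C_n^\pm$ and $V_n^\pm$ are non-empty, $$\max C_{n+1}^-<\min C_n^-<\max C_n^+<\min C_{n+1}^+,\qquad \max V_n^+<\min V_{n+1}^+,\qquad \min V_n^->\max V_{n+1}^-,$$ and, for $1\le i\le k_n$, $1\le j\le k_{-n}$, $$s_n(i,j)=\sum_{t\in C_n}y_{w^{(n)}_t,t}+\sum_{t\in V_n^+}y_{i,t}+\sum_{t\in V_n^-}y_{-j,t};$$ and such that, for every $1\le r\le m$, $R_1\text{-}\lim_{s\in FS[(s_n(i_n,j_n))_{n}]}T_r^s(x_0)=x_0$ uniformly in $((i_n,j_n))_n$. That is, for every neighbourhood $V$ of $x_0$ there is $n_0\in\mathbb N$ such that $T_r^s(x_0)\in V$ for all sequences $((i_n,j_n))_{n\in\mathbb N}$ with $1\le i_n\le k_n$, $1\le j_n\le k_{-n}$ and all $s\in FS[(s_n(i_n,j_n))_{n\ge n_0}]$. Moreover, if $(X,G)$ is minimal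 (no proper non-empty closed subset of $X$ is invariant under $G$), then the set of such points $x_0$ is dense in $X$. -/

import Mathlib

open Topology

/-- A located word over an alphabet `A`: a map from a non-empty finite set `dom` of integers to `A`.
Only the values of `letter` on `dom` are ever used. -/
structure LocatedWord (A : Type) where
  dom : Finset ℤ
  nonempty : dom.Nonempty
  letter : ℤ → A

/-- The bounding sequences: `k n ≥ 1` for `n ≠ 0`, and `(k n)`, `(k (-n))` are increasing in
`n = 1, 2, …`. The value `k 0` plays no role. -/
structure IsBounding (k : ℤ → ℕ) : Prop where
  pos : ∀ n : ℤ, n ≠ 0 → 1 ≤ k n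
  mono_pos : ∀ m n : ℤ, 1 ≤ m → m ≤ n → k m ≤ k n
  mono_neg : ∀ m n : ℤ, 1 ≤ m → m ≤ n → k (-m) ≤ k (-n)

/-- The letter `α_l = l` is allowed at position `n`: `l ∈ {1, …, k n}` if `n > 0` and
`l ∈ {-k n, …, -1}` if `n < 0`; no letter is allowed at `0`. -/
def IsLetterAt (k : ℤ → ℕ) (n l : ℤ) : Prop :=
  (0 < n ∧ 1 ≤ l ∧ l ≤ (k n : ℤ)) ∨ (n < 0 ∧ -(k n : ℤ) ≤ l ∧ l ≤ -1)

/-- The constant located words over `Σ = {α_n = n : n ∈ ℤ*}` dominated by `k`. -/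
def constWords (k : ℤ → ℕ) : Set (LocatedWord ℤ) :=
  {w | ∀ n ∈ w.dom, IsLetterAt k n (w.letter n)}

namespace LocatedWord

/-- Concatenation: the union of the two words (used for words with disjoint domains). -/
def concat {A : Type} (w u : LocatedWord A) : LocatedWord A where
  dom := w.dom ∪ u.dom
  nonempty := w.nonempty.mono Finset.subset_union_left
  letter n := if n ∈ w.dom then w.letter n else u.letter n

/-- The relation `w <_{R₁} u`: the domain of `u` splits into two non-empty parts, one to the left
and one to the right of the domain of `w`. -/
def R1 {A : Type} (w u : LocatedWord A) : Prop :=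
  ∃ A₁ A₂ : Finset ℤ, A₁.Nonempty ∧ A₂.Nonempty ∧ u.dom = A₁ ∪ A₂ ∧
    (∀ a ∈ A₁, ∀ n ∈ w.dom, a < n) ∧ (∀ n ∈ w.dom, ∀ a ∈ A₂, n < a)

/-! Words over `Σ ∪ {υ}`: the variable `υ` is `none`, the letter `α_l` is `some l`. -/

/-- The positions carrying a (constant) letter. -/
def C (w : LocatedWord (Option ℤ)) : Finset ℤ := w.dom.filter fun n => w.letter n ≠ none

/-- The negative positions carrying a (constant) letter. -/
def Cneg (w : LocatedWord (Option ℤ)) : Finset ℤ := w.C.filter fun n => n < 0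

/-- The positive positions carrying a (constant) letter. -/
def Cpos (w : LocatedWord (Option ℤ)) : Finset ℤ := w.C.filter fun n => 0 < n

/-- The negative positions carrying the variable. -/
def Vneg (w : LocatedWord (Option ℤ)) : Finset ℤ :=
  w.dom.filter fun n => n < 0 ∧ w.letter n = none

/-- The positive positions carrying the variable. -/
def Vpos (w : LocatedWord (Option ℤ)) : Finset ℤ :=
  w.dom.filter fun n => 0 < n ∧ w.letter n = none

/-- The index `l` of the letter `α_l` at a position in `w.C`. -/
def constLetter (w : LocatedWord (Option ℤ)) (n : ℤ) : ℤ := (w.letter n).getD 0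

end LocatedWord

/-- The variable located words over `Σ` dominated by `k` in which the variable occurs both at a
negative and at a positive position. -/
def varWords₀ (k : ℤ → ℕ) : Set (LocatedWord (Option ℤ)) :=
  {w | 0 ∉ w.dom ∧ (∀ n ∈ w.dom, ∀ l : ℤ, w.letter n = some l → IsLetterAt k n l) ∧
    w.Vneg.Nonempty ∧ w.Vpos.Nonempty}

/-- The sequences `w 1 <_{R₁} w 2 <_{R₁} …` of such variable words (the index `0` is not used). -/
def varWordSeqs (k : ℤ → ℕ) : Set (ℕ → LocatedWord (Option ℤ)) :=
  {w | ∀ n, 1 ≤ n → w n ∈ varWords₀ k ∧ (w n).R1 (w (n + 1))}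

section Semigroup

variable {S : Type*} [AddCommSemigroup S]

/-- A non-empty finite sum of elements of `S`, computed after adjoining a neutral element to `S`,
is an element of `S`. -/
theorem sum_coe_ne_zero {ι : Type*} (F : Finset ι) (hF : F.Nonempty) (f : ι → S) :
    (∑ t ∈ F, (f t : WithZero S)) ≠ 0 := by
  classical
  induction hF using Finset.Nonempty.cons_induction with
  | singleton a => simp
  | cons a s ha hs ih =>
    rw [Finset.sum_cons]
    obtain ⟨x, hx⟩ := WithZero.ne_zero_iff_exists.mp ih
    rw [← hx, ← WithZero.coe_add]
    exact WithZero.coe_ne_zero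

/-- `φ(w) = ∑_{n ∈ dom w} y_{w_n, n}`, a non-empty finite sum in the semigroup `S`. -/
noncomputable def phi (y : ℤ → ℤ → S) (w : LocatedWord ℤ) : S :=
  WithZero.unzero (sum_coe_ne_zero w.dom w.nonempty fun n => y (w.letter n) n)

/-- A family of continuous self-maps of `X` indexed by `S` with
`T^{φ(w₁)} T^{φ(w₂)} = T^{φ(w₁ ⋆ w₂)}` whenever `w₁ <_{R₁} w₂` are constant words. -/
structure IsWordSystem {X : Type*} [TopologicalSpace X] (k : ℤ → ℕ) (y : ℤ → ℤ → S)
    (T : S → X → X) : Prop where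
  continuous : ∀ s, Continuous (T s)
  comp : ∀ w₁ ∈ constWords k, ∀ w₂ ∈ constWords k, w₁.R1 w₂ →
    T (phi y w₁) ∘ T (phi y w₂) = T (phi y (w₁.concat w₂))

/-- The functions `s n : {1, …, k n} × {1, …, k (-n)} → S`, `n ≥ 1`, are built from the `y l n`
along blocks given by a sequence of variable words. The sums in `sum_eq` are taken in `S` with a
neutral element adjoined. -/
structure IsBlockSequence (k : ℤ → ℕ) (y : ℤ → ℤ → S) (w : ℕ → LocatedWord (Option ℤ))
    (s : ℕ → ℕ → ℕ → S) : Prop where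
  words : w ∈ varWordSeqs k
  Cneg_nonempty : ∀ n, 1 ≤ n → (w n).Cneg.Nonempty
  Cpos_nonempty : ∀ n, 1 ≤ n → (w n).Cpos.Nonempty
  Cneg_lt : ∀ n, 1 ≤ n → ∀ a ∈ (w (n + 1)).Cneg, ∀ b ∈ (w n).Cneg, a < b
  Cpos_lt : ∀ n, 1 ≤ n → ∀ a ∈ (w n).Cpos, ∀ b ∈ (w (n + 1)).Cpos, a < b
  Vneg_lt : ∀ n, 1 ≤ n → ∀ a ∈ (w (n + 1)).Vneg, ∀ b ∈ (w n).Vneg, a < b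
  Vpos_lt : ∀ n, 1 ≤ n → ∀ a ∈ (w n).Vpos, ∀ b ∈ (w (n + 1)).Vpos, a < b
  sum_eq : ∀ n : ℕ, 1 ≤ n → ∀ i j : ℕ, 1 ≤ i → i ≤ k n → 1 ≤ j → j ≤ k (-n) →
    (s n i j : WithZero S) =
      (∑ t ∈ (w n).C, (y ((w n).constLetter t) t : WithZero S)) +
        (∑ t ∈ (w n).Vpos, (y i t : WithZero S)) + ∑ t ∈ (w n).Vneg, (y (-j) t : WithZero S)

/-- `R₁-lim x_t = x₀` over `t ∈ FS[(s_n(i_n, j_n))_n]`, uniformly in all sequences `(i_n, j_n)` with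
`1 ≤ i_n ≤ k n` and `1 ≤ j_n ≤ k (-n)`: the index `n₀` depends only on the neighbourhood. The set
`FS[(s_n(i_n, j_n))_{n ≥ n₀}]` consists of the sums over non-empty finite sets of indices `≥ n₀`. -/
def UniformR1Lim {X : Type*} [TopologicalSpace X] (k : ℤ → ℕ) (s : ℕ → ℕ → ℕ → S)
    (x : S → X) (x₀ : X) : Prop :=
  ∀ V ∈ 𝓝 x₀, ∃ n₀ : ℕ, 1 ≤ n₀ ∧ ∀ i j : ℕ → ℕ,
    (∀ n : ℕ, 1 ≤ n → 1 ≤ i n ∧ i n ≤ k n ∧ 1 ≤ j n ∧ j n ≤ k (-n)) →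
      ∀ t ∈ Hindman.FS (Stream'.drop n₀ (fun n => s n (i n) (j n))), x t ∈ V

/-- There are block functions along which `T_r^t x₀` converges to `x₀`, simultaneously for all of
the finitely many systems `T_r`. -/
def IsBlockRecurrentPoint {X : Type*} [TopologicalSpace X] (k : ℤ → ℕ) (y : ℤ → ℤ → S) {m : ℕ}
    (T : Fin m → S → X → X) (x₀ : X) : Prop :=
  ∃ (w : ℕ → LocatedWord (Option ℤ)) (s : ℕ → ℕ → ℕ → S), IsBlockSequence k y w s ∧
    ∀ r : Fin m, UniformR1Lim k s (fun t => T r t x₀) x₀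

end Semigroup

/-- `(X, G)` is minimal: no proper non-empty closed subset of `X` is invariant under `G`. -/
def IsMinimalGroup {X : Type*} [TopologicalSpace X] (G : Subgroup (X ≃ₜ X)) : Prop :=
  ∀ A : Set X, IsClosed A → A.Nonempty → (∀ g ∈ G, ∀ x ∈ A, g x ∈ A) → A = Set.univ

/-! The heart is multiple recurrence in a minimal closed `G`-invariant set `Y`. If an open `U` meets
`Y`, finitely many elements of `G` suffice to bring each point of `Y` into `U`. Colour the words of
a Hales–Jewett cube by an element that returns the corresponding translate of a base point. A
monochromatic line, together with commutativity of `G`, gives one point `x` of `U ∩ Y` and one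
variable word all of whose substitutions send `x` into `U` (`IsMinimalClosed.exists_block`).

By continuity a small ball around `x` does the same. Iterating gives open sets with closure of `U (p
+ 1)` inside `U p` and diameters tending to `0`, and words, each straddling the previous ones, whose
maps send `U (p + 1)` into `U p`. Compactness gives a common point `x₀`. A finite sum acts as a
composition of these maps, so `mem_of_mem_FS` keeps its value at `x₀` in `U p`, uniformly in the
chosen letters. -/

namespace LocatedWord

/-! ### Words far from the origin. -/

variable {A : Type}

/-- Every position of the word has absolute value `> N`, and there are positions of both signs. -/
structure Beyond (N : ℕ) (w : LocatedWord A) : Prop where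
  lt_abs : ∀ t ∈ w.dom, (N : ℤ) < |t|
  exists_neg : ∃ t ∈ w.dom, t < 0
  exists_pos : ∃ t ∈ w.dom, 0 < t

theorem Beyond.mono {M N : ℕ} (h : M ≤ N) {w : LocatedWord A} (hw : w.Beyond N) : w.Beyond M :=
  ⟨fun t ht => lt_of_le_of_lt (by exact_mod_cast h) (hw.lt_abs t ht), hw.exists_neg, hw.exists_pos⟩

theorem Beyond.concat {N : ℕ} {w u : LocatedWord A} (hw : w.Beyond N) (hu : u.Beyond N) :
    (w.concat u).Beyond N where
  lt_abs t ht := by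
    rcases Finset.mem_union.mp ht with h | h
    · exact hw.lt_abs t h
    · exact hu.lt_abs t h
  exists_neg := let ⟨t, ht, h⟩ := hw.exists_neg; ⟨t, Finset.mem_union_left _ ht, h⟩
  exists_pos := let ⟨t, ht, h⟩ := hw.exists_pos; ⟨t, Finset.mem_union_left _ ht, h⟩

/-- The domain of `u` is cut at `0`: both halves are non-empty and lie outside `[-N, N]`. -/
theorem Beyond.R1 {N : ℕ} {w u : LocatedWord A} (hw : ∀ t ∈ w.dom, |t| ≤ (N : ℤ))
    (hu : u.Beyond N) : w.R1 u := by
  obtain ⟨a, ha, ha'⟩ := hu.exists_neg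
  obtain ⟨b, hb, hb'⟩ := hu.exists_pos
  refine ⟨u.dom.filter (· < 0), u.dom.filter (0 < ·), ⟨a, by simp [ha, ha']⟩,
    ⟨b, by simp [hb, hb']⟩, ?_, ?_, ?_⟩
  · ext t
    have := hu.lt_abs t
    simp only [Finset.mem_union, Finset.mem_filter]
    constructor
    · intro ht
      have h0 : t ≠ 0 := by
        rintro rfl
        have := this ht
        simp at this
        omega
      rcases lt_or_gt_of_ne h0 with h | h
      · exact Or.inl ⟨ht, h⟩
      · exact Or.inr ⟨ht, h⟩
    · rintro (h | h) <;> exact h.1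
  · intro t ht n hn
    rw [Finset.mem_filter] at ht
    have h1 := hu.lt_abs t ht.1
    have h2 := hw n hn
    rw [abs_of_neg ht.2] at h1
    have := neg_abs_le n
    omega
  · intro n hn t ht
    rw [Finset.mem_filter] at ht
    have h1 := hu.lt_abs t ht.1
    have h2 := hw n hn
    rw [abs_of_pos ht.2] at h1
    have := le_abs_self n
    omega

theorem disjoint_dom_of_beyond {N : ℕ} {w u : LocatedWord A} (hw : ∀ t ∈ w.dom, |t| ≤ (N : ℤ))
    (hu : u.Beyond N) : Disjoint w.dom u.dom :=
  Finset.disjoint_left.mpr fun t ht ht' => absurd (hu.lt_abs t ht') (not_lt.mpr (hw t ht))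

theorem exists_abs_le (w : LocatedWord A) : ∃ N : ℕ, ∀ t ∈ w.dom, |t| ≤ (N : ℤ) :=
  ⟨w.dom.sup Int.natAbs, fun t ht => by
    rw [Int.abs_eq_natAbs]
    exact_mod_cast Finset.le_sup (f := Int.natAbs) ht⟩

/-- Substitution of the letter `i` for the variable at the positive positions, and of `-j` at the
other ones. -/
def subst (w : LocatedWord (Option ℤ)) (i j : ℕ) : LocatedWord ℤ where
  dom := w.dom
  nonempty := w.nonempty
  letter t := (w.letter t).getD (if 0 < t then i else -j)

theorem Beyond.subst {N : ℕ} {w : LocatedWord (Option ℤ)} (hw : w.Beyond N) (i j : ℕ) :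
    (w.subst i j).Beyond N :=
  ⟨hw.lt_abs, hw.exists_neg, hw.exists_pos⟩

/-! ### Explicit variable words with letters and variables of both signs. -/

/-- The word on the positions `±q`, `±(q + 1)`, for `q = 2 (N + l + 1)`, `l ∈ F`, with the variable
at the even positions and the letters `±1` at the odd ones. -/
def block (N : ℕ) (F : Finset ℕ) (hF : F.Nonempty) : LocatedWord (Option ℤ) where
  dom := F.biUnion fun l =>
    {2 * (N + l + 1 : ℤ), 2 * (N + l + 1 : ℤ) + 1, -(2 * (N + l + 1 : ℤ)),
      -(2 * (N + l + 1 : ℤ) + 1)}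
  nonempty := by
    obtain ⟨l, hl⟩ := hF
    exact ⟨2 * (N + l + 1 : ℤ), by simp only [Finset.mem_biUnion]; exact ⟨l, hl, by simp⟩⟩
  letter t := if Even t then none else some t.sign

variable {N : ℕ} {F : Finset ℕ} {hF : F.Nonempty}

theorem mem_block_dom {t : ℤ} : t ∈ (block N F hF).dom ↔ ∃ l ∈ F, t = 2 * (N + l + 1 : ℤ) ∨
    t = 2 * (N + l + 1 : ℤ) + 1 ∨ t = -(2 * (N + l + 1 : ℤ)) ∨ t = -(2 * (N + l + 1 : ℤ) + 1) := by
  simp [block]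

theorem block_beyond : (block N F hF).Beyond N := by
  obtain ⟨l, hl⟩ := hF
  refine ⟨fun t ht => ?_, ⟨-(2 * (N + l + 1 : ℤ)), mem_block_dom.mpr ⟨l, hl, by simp⟩, by omega⟩,
    ⟨2 * (N + l + 1 : ℤ), mem_block_dom.mpr ⟨l, hl, by simp⟩, by omega⟩⟩
  obtain ⟨l, -, h⟩ := mem_block_dom.mp ht
  rw [lt_abs]
  omega

theorem block_Cneg_nonempty : (block N F hF).Cneg.Nonempty := by
  obtain ⟨l, hl⟩ := id hF
  refine ⟨-(2 * (N + l + 1 : ℤ) + 1), ?_⟩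
  rw [Cneg, C, Finset.mem_filter, Finset.mem_filter, mem_block_dom]
  refine ⟨⟨⟨l, hl, by simp⟩, ?_⟩, by omega⟩
  have : ¬ Even (-(2 * (N + l + 1 : ℤ) + 1)) := by rw [even_neg]; simp
  simp only [block, if_neg this]
  exact Option.some_ne_none _

theorem block_Cpos_nonempty : (block N F hF).Cpos.Nonempty := by
  obtain ⟨l, hl⟩ := id hF
  refine ⟨2 * (N + l + 1 : ℤ) + 1, ?_⟩
  rw [Cpos, C, Finset.mem_filter, Finset.mem_filter, mem_block_dom]
  refine ⟨⟨⟨l, hl, by simp⟩, ?_⟩, by omega⟩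
  have : ¬ Even (2 * (N + l + 1 : ℤ) + 1) := by simp
  simp [block, this]

theorem block_Vneg_nonempty : (block N F hF).Vneg.Nonempty := by
  obtain ⟨l, hl⟩ := id hF
  refine ⟨-(2 * (N + l + 1 : ℤ)), ?_⟩
  rw [Vneg, Finset.mem_filter, mem_block_dom]
  refine ⟨⟨l, hl, by simp⟩, by omega, ?_⟩
  have : Even (-(2 * (N + l + 1 : ℤ))) := by simp
  simp [block, this]

theorem block_Vpos_nonempty : (block N F hF).Vpos.Nonempty := by
  obtain ⟨l, hl⟩ := id hF
  refine ⟨2 * (N + l + 1 : ℤ), ?_⟩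
  rw [Vpos, Finset.mem_filter, mem_block_dom]
  refine ⟨⟨l, hl, by simp⟩, by omega, ?_⟩
  have : Even (2 * (N + l + 1 : ℤ)) := by simp
  simp [block, this]

theorem Beyond.zero_notMem {w : LocatedWord A} (hw : w.Beyond N) : (0 : ℤ) ∉ w.dom := by
  intro h
  have := hw.lt_abs 0 h
  simp at this
  omega

end LocatedWord

/-! ### Admissible substitutions and additivity of `φ`. -/

section BlockRecurrence

open LocatedWord

variable {S : Type*} [AddCommSemigroup S] {k : ℤ → ℕ} {y : ℤ → ℤ → S}

theorem IsBounding.isLetterAt_one (hk : IsBounding k) {t : ℤ} (ht : t ≠ 0) :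
    IsLetterAt k t t.sign := by
  have := hk.pos t ht
  rcases lt_or_gt_of_ne ht with h | h
  · right
    rw [Int.sign_eq_neg_one_of_neg h]
    omega
  · left
    rw [Int.sign_eq_one_of_pos h]
    omega

theorem IsBounding.block_mem_varWords₀ (hk : IsBounding k) {N : ℕ} {F : Finset ℕ}
    {hF : F.Nonempty} : block N F hF ∈ varWords₀ k := by
  refine ⟨block_beyond.zero_notMem, fun t ht l hl => ?_, block_Vneg_nonempty, block_Vpos_nonempty⟩
  have h0 : t ≠ 0 := fun h => block_beyond.zero_notMem (h ▸ ht)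
  simp only [block] at hl
  split_ifs at hl
  rw [← Option.some.inj hl]
  exact hk.isLetterAt_one h0

/-- All positions have absolute value above `n`, so monotonicity of `k` makes letters bounded by `k
n` and `k (-n)` admissible there. -/
theorem IsBounding.subst_mem_constWords (hk : IsBounding k) {n N : ℕ} (hn : 1 ≤ n) (hN : n ≤ N)
    {w : LocatedWord (Option ℤ)} (hw : w ∈ varWords₀ k) (hwN : w.Beyond N) {i j : ℕ} (hi : 1 ≤ i)
    (hi' : i ≤ k n) (hj : 1 ≤ j) (hj' : j ≤ k (-n)) : w.subst i j ∈ constWords k := by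
  intro t ht
  have htN := hwN.lt_abs t ht
  simp only [subst]
  cases h : w.letter t with
  | some l => exact hw.2.1 t ht l h
  | none =>
    have h0 : t ≠ 0 := fun h => hwN.zero_notMem (h ▸ ht)
    rcases lt_or_gt_of_ne h0 with h | h
    · right
      rw [abs_of_neg h] at htN
      have := hk.mono_neg n (-t) (by omega) (by omega)
      rw [neg_neg] at this
      rw [Option.getD_none, if_neg (not_lt.mpr h.le)]
      omega
    · left
      rw [abs_of_pos h] at htN
      have := hk.mono_pos n t (by omega) (by omega)
      rw [Option.getD_none, if_pos h]
      omega

theorem concat_mem_constWords {w u : LocatedWord ℤ} (hw : w ∈ constWords k)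
    (hu : u ∈ constWords k) : w.concat u ∈ constWords k := by
  intro t ht
  simp only [concat]
  split_ifs with h
  · exact hw t h
  · exact hu t ((Finset.mem_union.mp ht).resolve_left h)

theorem coe_phi (w : LocatedWord ℤ) :
    ((phi y w : S) : WithZero S) = ∑ t ∈ w.dom, (y (w.letter t) t : WithZero S) :=
  WithZero.coe_unzero _

theorem phi_concat {w u : LocatedWord ℤ} (h : Disjoint w.dom u.dom) :
    phi y (w.concat u) = phi y w + phi y u := by
  apply WithZero.coe_injective
  rw [WithZero.coe_add, coe_phi, coe_phi, coe_phi]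
  change ∑ t ∈ w.dom ∪ u.dom, _ = _
  rw [Finset.sum_union h]
  congr 1
  · exact Finset.sum_congr rfl fun t ht => by simp [concat, ht]
  · exact Finset.sum_congr rfl fun t ht => by
      simp [concat, Finset.disjoint_right.mp h ht]

theorem coe_phi_subst {w : LocatedWord (Option ℤ)} (h0 : 0 ∉ w.dom) (i j : ℕ) :
    ((phi y (w.subst i j) : S) : WithZero S) =
      (∑ t ∈ w.C, (y (w.constLetter t) t : WithZero S)) +
        (∑ t ∈ w.Vpos, (y i t : WithZero S)) + ∑ t ∈ w.Vneg, (y (-j) t : WithZero S) := by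
  have hV : w.dom.filter (fun t => ¬ w.letter t ≠ none) = w.Vpos ∪ w.Vneg := by
    ext t
    simp only [Vpos, Vneg, Finset.mem_union, Finset.mem_filter, not_not]
    have : t ∈ w.dom → t ≠ 0 := fun h h' => h0 (h' ▸ h)
    constructor
    · rintro ⟨h1, h2⟩
      rcases lt_or_gt_of_ne (this h1) with h | h
      · exact Or.inr ⟨h1, h, h2⟩
      · exact Or.inl ⟨h1, h, h2⟩
    · rintro (⟨h1, -, h2⟩ | ⟨h1, -, h2⟩) <;> exact ⟨h1, h2⟩
  have hd : Disjoint w.Vpos w.Vneg := by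
    rw [Finset.disjoint_left]
    intro t h1 h2
    simp only [Vpos, Vneg, Finset.mem_filter] at h1 h2
    omega
  rw [coe_phi]
  change ∑ t ∈ w.dom, _ = _
  rw [← Finset.sum_filter_add_sum_filter_not w.dom (fun t => w.letter t ≠ none), hV,
    Finset.sum_union hd, ← add_assoc]
  congr 1
  · congr 1
    · refine Finset.sum_congr rfl fun t ht => ?_
      obtain ⟨l, hl⟩ := Option.ne_none_iff_exists.mp (Finset.mem_filter.mp ht).2
      simp [subst, constLetter, ← hl]
    · refine Finset.sum_congr rfl fun t ht => ?_
      obtain ⟨-, h1, h2⟩ := Finset.mem_filter.mp ht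
      simp [subst, h1, h2]
  · refine Finset.sum_congr rfl fun t ht => ?_
    obtain ⟨-, h1, h2⟩ := Finset.mem_filter.mp ht
    simp [subst, not_lt.mpr h1.le, h2]

theorem LocatedWord.subst_block_insert {N a : ℕ} {F : Finset ℕ} (hF : F.Nonempty) (i j : ℕ) :
    (block N (insert a F) (Finset.insert_nonempty a F)).subst i j =
      ((block N F hF).subst i j).concat ((block N {a} (Finset.singleton_nonempty a)).subst i j) := by
  simp only [subst, concat, block, LocatedWord.mk.injEq, Finset.biUnion_insert,
    Finset.singleton_biUnion, ite_self, and_true]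
  rw [Finset.union_comm]

/-- Turns one long block into a product over single blocks, the form that Hales–Jewett handles.
Multiplicativity is available only along `R1`, so the blocks are added outwards, largest index last.
-/
theorem phi_block_eq_prod {H : Type*} [CommMonoid H] {T : S → H}
    (hT : ∀ w₁ ∈ constWords k, ∀ w₂ ∈ constWords k, w₁.R1 w₂ →
      T (phi y w₁) * T (phi y w₂) = T (phi y (w₁.concat w₂)))
    {N i j : ℕ} (hmem : ∀ F hF, (block N F hF).subst i j ∈ constWords k) (F : Finset ℕ) :
    ∀ hF : F.Nonempty, T (phi y ((block N F hF).subst i j)) =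
      ∏ l ∈ F, T (phi y ((block N {l} (Finset.singleton_nonempty l)).subst i j)) := by
  induction F using Finset.induction_on_max with
  | empty => exact fun hF => absurd hF (by simp)
  | insert a F ha ih =>
    intro hF
    rcases F.eq_empty_or_nonempty with rfl | hF'
    · simp
    -- The bound separates the shells: indices below `a` reach at most `2 (N + a) + 1`, and the
    -- block of `a` starts at `2 (N + a) + 2`.
    · have hM : ∀ t ∈ (block N F hF').dom, |t| ≤ ((2 * (N + a) + 1 : ℕ) : ℤ) := by
        intro t ht
        obtain ⟨l, hl, h⟩ := mem_block_dom.mp ht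
        have := ha l hl
        rw [abs_le]
        push_cast
        omega
      have hB : (block N {a} (Finset.singleton_nonempty a)).Beyond (2 * (N + a) + 1) := by
        refine ⟨fun t ht => ?_, block_beyond.exists_neg, block_beyond.exists_pos⟩
        obtain ⟨l, hl, h⟩ := mem_block_dom.mp ht
        rw [Finset.mem_singleton] at hl
        rw [lt_abs]
        push_cast
        omega
      rw [subst_block_insert hF', ← hT _ (hmem F hF') _ (hmem _ _)
        (Beyond.R1 (w := (block N F hF').subst i j) hM (hB.subst i j)), ih hF',
        Finset.prod_insert (fun h => (ha a h).false), mul_comm]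

/-! ### Minimal sets and recurrence along one block. -/

/-- `Y` is a minimal non-empty closed invariant set for the action `ρ`. -/
structure IsMinimalClosed {X H : Type*} [TopologicalSpace X] [Group H] (ρ : H →* (X ≃ₜ X))
    (Y : Set X) : Prop where
  closed : IsClosed Y
  nonempty : Y.Nonempty
  mapsTo : ∀ g, ∀ x ∈ Y, ρ g x ∈ Y
  eq_of_subset : ∀ A ⊆ Y, IsClosed A → A.Nonempty → (∀ g, ∀ x ∈ A, ρ g x ∈ A) → A = Y

theorem exists_isMinimalClosed {X H : Type*} [TopologicalSpace X] [CompactSpace X] [Nonempty X]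
    [Group H] (ρ : H →* (X ≃ₜ X)) : ∃ Y, IsMinimalClosed ρ Y := by
  have hlb : ∀ c ⊆ {A : Set X | IsClosed A ∧ A.Nonempty ∧ ∀ g, ∀ x ∈ A, ρ g x ∈ A},
      IsChain (· ⊆ ·) c → c.Nonempty →
      ∃ B ∈ {A : Set X | IsClosed A ∧ A.Nonempty ∧ ∀ g, ∀ x ∈ A, ρ g x ∈ A}, ∀ A ∈ c, B ⊆ A := by
    intro c hc hchain hne
    refine ⟨⋂₀ c, ⟨isClosed_sInter fun A hA => (hc hA).1, ?_, fun g x hx A hA =>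
      (hc hA).2.2 g x (hx A hA)⟩, fun A hA => Set.sInter_subset_of_mem hA⟩
    have := hne.to_subtype
    exact IsCompact.nonempty_sInter_of_directed_nonempty_isCompact_isClosed
      (fun A hA B hB => (hchain.total hA hB).elim (fun h => ⟨A, hA, subset_rfl, h⟩)
        fun h => ⟨B, hB, h, subset_rfl⟩) (fun A hA => (hc hA).2.1) (fun A hA => (hc hA).1.isCompact)
      (fun A hA => (hc hA).1)
  obtain ⟨Y, -, hY⟩ := zorn_superset_nonempty _ hlb Set.univ
    ⟨isClosed_univ, Set.univ_nonempty, fun _ _ _ => trivial⟩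
  exact ⟨Y, hY.prop.1, hY.prop.2.1, hY.prop.2.2, fun A hA h1 h2 h3 =>
    hA.antisymm (hY.le_of_le ⟨h1, h2, h3⟩ hA)⟩

/-- The points of `Y` whose orbit misses `U` form a closed invariant set. It is not all of `Y`,
hence empty by minimality; compactness does the rest. -/
theorem IsMinimalClosed.exists_finset_cover {X H : Type*} [TopologicalSpace X] [CompactSpace X]
    [Group H] {ρ : H →* (X ≃ₜ X)} {Y : Set X} (hY : IsMinimalClosed ρ Y) {U : Set X}
    (hU : IsOpen U) (hUY : (U ∩ Y).Nonempty) : ∃ E : Finset H, ∀ x ∈ Y, ∃ g ∈ E, ρ g x ∈ U := by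
  have hopen : ∀ g, IsOpen (ρ g ⁻¹' U) := fun g => hU.preimage (ρ g).continuous
  have hcover : Y ⊆ ⋃ g, ρ g ⁻¹' U := by
    by_contra hnot
    obtain ⟨x, hxY, hx⟩ := Set.not_subset.mp hnot
    have h := hY.eq_of_subset (Y \ ⋃ g, ρ g ⁻¹' U) Set.sdiff_subset
      (hY.closed.sdiff (isOpen_iUnion hopen)) ⟨x, hxY, hx⟩ ?_
    · obtain ⟨z, hzU, hzY⟩ := hUY
      rw [← h] at hzY
      exact hzY.2 (Set.mem_iUnion.mpr ⟨1, by simpa using hzU⟩)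
    · rintro g z ⟨hzY, hz⟩
      refine ⟨hY.mapsTo g z hzY, fun hmem => hz ?_⟩
      obtain ⟨g', hg'⟩ := Set.mem_iUnion.mp hmem
      exact Set.mem_iUnion.mpr ⟨g' * g, by simpa [map_mul] using hg'⟩
  obtain ⟨E, hE⟩ := hY.closed.isCompact.elim_finite_subcover _ hopen hcover
  refine ⟨E, fun x hx => ?_⟩
  simpa using hE hx

/-- Multiple recurrence along a single block, from the Hales–Jewett theorem. -/
theorem IsMinimalClosed.exists_block {X H : Type*} [TopologicalSpace X] [CompactSpace X]
    [CommGroup H] {ρ : H →* (X ≃ₜ X)} {Y : Set X} (hY : IsMinimalClosed ρ Y) {U : Set X}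
    (hU : IsOpen U) (hUY : (U ∩ Y).Nonempty) (hk : IsBounding k) {m : ℕ} {T : Fin m → S → H}
    (hT : ∀ r, ∀ w₁ ∈ constWords k, ∀ w₂ ∈ constWords k, w₁.R1 w₂ →
      T r (phi y w₁) * T r (phi y w₂) = T r (phi y (w₁.concat w₂)))
    {n N : ℕ} (hn : 1 ≤ n) (hN : n ≤ N) :
    ∃ (F : Finset ℕ) (hF : F.Nonempty), ∃ x ∈ U ∩ Y, ∀ r i j, 1 ≤ i → i ≤ k n → 1 ≤ j →
      j ≤ k (-n) → ρ (T r (phi y ((block N F hF).subst i j))) x ∈ U := by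
  obtain ⟨E, hE⟩ := hY.exists_finset_cover hU hUY
  obtain ⟨x₀, hx₀⟩ := hY.nonempty
  -- The extra letter `none` acts as the identity; it will put the recurrent point itself into `U`.
  -- The shifts by `1` turn `Fin` indices into letters starting at `1`.
  let c : Option (Fin m × Fin (k n) × Fin (k (-n))) → ℕ → H := fun a l =>
    a.elim 1 fun p => T p.1 (phi y ((block N {l} (Finset.singleton_nonempty l)).subst
      (p.2.1 + 1) (p.2.2 + 1)))
  obtain ⟨ι, _, hι⟩ := Combinatorics.Line.exists_mono_in_high_dimension
    (Option (Fin m × Fin (k n) × Fin (k (-n)))) E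
  let e : ι → ℕ := fun i => Fintype.equivFin ι i
  have he : Function.Injective e := Fin.val_injective.comp (Fintype.equivFin ι).injective
  let Φ : (ι → Option (Fin m × Fin (k n) × Fin (k (-n)))) → H := fun f => ∏ i, c (f i) (e i)
  -- The colour of a cube word is an element of `E` returning its translate of `x₀` to `U`.
  choose γ hγE hγ using fun f => hE _ (hY.mapsTo (Φ f) x₀ hx₀)
  obtain ⟨L, g, hg⟩ := hι fun f => ⟨γ f, hγE f⟩
  classical
  let F : Finset ℕ := (Finset.univ.filter fun i => L.idxFun i = none).image e
  have hF : F.Nonempty := by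
    obtain ⟨i, hi⟩ := L.proper
    exact ⟨e i, Finset.mem_image_of_mem e (by simp [hi])⟩
  -- Contribution of the fixed coordinates of the line, the same for every letter.
  let K : H := ∏ i with ¬ L.idxFun i = none, c ((L.idxFun i).getD none) (e i)
  have hΦ : ∀ a, Φ (L a) = (∏ l ∈ F, c a l) * K := by
    intro a
    rw [Finset.prod_image he.injOn]
    change ∏ i, c (L a i) (e i) = _
    rw [← Finset.prod_filter_mul_prod_filter_not Finset.univ (fun i => L.idxFun i = none)]
    congr 1
    · refine Finset.prod_congr rfl fun i hi => ?_
      rw [L.apply_none a i (by simpa using hi)]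
    · refine Finset.prod_congr rfl fun i hi => ?_
      obtain ⟨b, hb⟩ := Option.ne_none_iff_exists'.mp (Finset.mem_filter.mp hi).2
      simp [hb]
  have hmono : ∀ a, ρ (∏ l ∈ F, c a l) (ρ (g * K) x₀) ∈ U := by
    intro a
    have h := hγ (L a)
    rw [show γ (L a) = g from congrArg Subtype.val (hg a), hΦ] at h
    -- Commutativity moves `g` past the variable part, so the point `ρ (g * K) x₀` does not depend
    -- on `a`.
    rw [← Homeomorph.mul_apply, ← map_mul, mul_left_comm, map_mul, Homeomorph.mul_apply]
    exact h
  refine ⟨F, hF, ρ (g * K) x₀, ⟨?_, hY.mapsTo _ _ hx₀⟩, fun r i j hi hi' hj hj' => ?_⟩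
  · simpa [c] using hmono none
  · have h := hmono (some (r, ⟨i - 1, by omega⟩, ⟨j - 1, by omega⟩))
    rw [phi_block_eq_prod (hT r) fun F hF => hk.subst_mem_constWords hn hN hk.block_mem_varWords₀
      block_beyond hi hi' hj hj']
    simpa [c, Nat.sub_add_cancel hi, Nat.sub_add_cancel hj] using h

/-! ### Sequences of return words and their finite sums. -/

/-- The word `w` lies beyond `N`, within `N'`, and the maps `T_r^s` for the sums `s` along `w` send
the open set `U'`, of diameter at most `ε` and with closure inside `U`, into `U`. -/
structure IsReturnWord {X : Type*} [MetricSpace X] (k : ℤ → ℕ) (y : ℤ → ℤ → S) {m : ℕ}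
    (T : Fin m → S → X → X) (n : ℕ) (ε : ℝ) (N : ℕ) (U : Set X) (w : LocatedWord (Option ℤ))
    (N' : ℕ) (U' : Set X) : Prop where
  mem : w ∈ varWords₀ k
  Cneg_nonempty : w.Cneg.Nonempty
  Cpos_nonempty : w.Cpos.Nonempty
  beyond : w.Beyond N
  le_beyond : w.Beyond n
  abs_le : ∀ t ∈ w.dom, |t| ≤ (N' : ℤ)
  closure_subset : closure U' ⊆ U
  dist_lt : ∀ a ∈ U', ∀ b ∈ U', dist a b < ε
  mapsTo : ∀ r i j, 1 ≤ i → i ≤ k n → 1 ≤ j → j ≤ k (-n) →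
    ∀ x ∈ U', T r (phi y (w.subst i j)) x ∈ U

theorem isBlockSequence_of_isReturnWord {X : Type*} [MetricSpace X] {m : ℕ}
    {T : Fin m → S → X → X} {ε : ℕ → ℝ} {N : ℕ → ℕ} {U : ℕ → Set X}
    {w : ℕ → LocatedWord (Option ℤ)}
    (h : ∀ p, IsReturnWord k y T (p + 1) (ε p) (N p) (U p) (w (p + 1)) (N (p + 1)) (U (p + 1))) :
    IsBlockSequence k y w (fun n i j => phi y ((w n).subst i j)) := by
  have h' : ∀ n, 1 ≤ n → ∃ p, n = p + 1 := fun n hn => ⟨n - 1, by omega⟩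
  have hsep : ∀ p, ∀ a ∈ (w (p + 2)).dom, ∀ b ∈ (w (p + 1)).dom, |b| < |a| := fun p a ha b hb =>
    lt_of_le_of_lt ((h p).abs_le b hb) ((h (p + 1)).beyond.lt_abs a ha)
  constructor
  · intro n hn
    obtain ⟨p, rfl⟩ := h' n hn
    exact ⟨(h p).mem, Beyond.R1 (h p).abs_le (h (p + 1)).beyond⟩
  · intro n hn
    obtain ⟨p, rfl⟩ := h' n hn
    exact (h p).Cneg_nonempty
  · intro n hn
    obtain ⟨p, rfl⟩ := h' n hn
    exact (h p).Cpos_nonempty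
  · intro n hn a ha b hb
    obtain ⟨p, rfl⟩ := h' n hn
    simp only [Cneg, C, Finset.mem_filter] at ha hb
    have := hsep p a ha.1.1 b hb.1.1
    rwa [abs_of_neg ha.2, abs_of_neg hb.2, neg_lt_neg_iff] at this
  · intro n hn a ha b hb
    obtain ⟨p, rfl⟩ := h' n hn
    simp only [Cpos, C, Finset.mem_filter] at ha hb
    have := hsep p b hb.1.1 a ha.1.1
    rwa [abs_of_pos ha.2, abs_of_pos hb.2] at this
  · intro n hn a ha b hb
    obtain ⟨p, rfl⟩ := h' n hn
    simp only [Vneg, Finset.mem_filter] at ha hb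
    have := hsep p a ha.1 b hb.1
    rwa [abs_of_neg ha.2.1, abs_of_neg hb.2.1, neg_lt_neg_iff] at this
  · intro n hn a ha b hb
    obtain ⟨p, rfl⟩ := h' n hn
    simp only [Vpos, Finset.mem_filter] at ha hb
    have := hsep p b hb.1 a ha.1
    rwa [abs_of_pos ha.2.1, abs_of_pos hb.2.1] at this
  · intro n hn i j _ _ _ _
    obtain ⟨p, rfl⟩ := h' n hn
    exact coe_phi_subst (h p).mem.1 i j

/-- Induction on the finite sum, peeling off its innermost word. The witness `W` is carried along
because the composition law concerns only values of `φ` on words in relation `R1`, which `Beyond`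
supplies. -/
theorem mem_of_mem_FS {X : Type*} [MetricSpace X] {m : ℕ}
    {T : Fin m → S → X → X} {ε : ℕ → ℝ} {N : ℕ → ℕ} {U : ℕ → Set X}
    {w : ℕ → LocatedWord (Option ℤ)} (hk : IsBounding k)
    (hT : ∀ r, ∀ w₁ ∈ constWords k, ∀ w₂ ∈ constWords k, w₁.R1 w₂ →
      T r (phi y w₁) ∘ T r (phi y w₂) = T r (phi y (w₁.concat w₂)))
    (h : ∀ p, IsReturnWord k y T (p + 1) (ε p) (N p) (U p) (w (p + 1)) (N (p + 1)) (U (p + 1)))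
    {x₀ : X} (hx₀ : ∀ p, x₀ ∈ U p) {i j : ℕ → ℕ}
    (hij : ∀ n : ℕ, 1 ≤ n → 1 ≤ i n ∧ i n ≤ k n ∧ 1 ≤ j n ∧ j n ≤ k (-n)) (p : ℕ) {t : S}
    (ht : t ∈ Hindman.FS (Stream'.drop (p + 1) fun n => phi y ((w n).subst (i n) (j n)))) :
    ∃ W ∈ constWords k, phi y W = t ∧ W.Beyond (N p) ∧ ∀ r, T r t x₀ ∈ U p := by
  have hN : ∀ p, N p ≤ N (p + 1) := fun p => by
    obtain ⟨t, ht⟩ := (w (p + 1)).nonempty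
    exact_mod_cast ((h p).beyond.lt_abs t ht).le.trans ((h p).abs_le t ht)
  have hconst : ∀ p, (w (p + 1)).subst (i (p + 1)) (j (p + 1)) ∈ constWords k := fun p =>
    have ⟨h1, h2, h3, h4⟩ := hij (p + 1) (by omega)
    hk.subst_mem_constWords (n := p + 1) (by omega) le_rfl (h p).mem (h p).le_beyond h1 h2 h3 h4
  have hmaps : ∀ p r, ∀ z ∈ U (p + 1),
      T r (phi y ((w (p + 1)).subst (i (p + 1)) (j (p + 1)))) z ∈ U p := fun p r z hz =>
    have ⟨h1, h2, h3, h4⟩ := hij (p + 1) (by omega)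
    (h p).mapsTo r _ _ h1 h2 h3 h4 z hz
  generalize ha : Stream'.drop (p + 1) (fun n => phi y ((w n).subst (i n) (j n))) = a at ht
  induction ht generalizing p with
  | head' a =>
    have hhead : a.head = phi y ((w (p + 1)).subst (i (p + 1)) (j (p + 1))) :=
      ha ▸ Stream'.head_drop ..
    rw [hhead]
    exact ⟨_, hconst p, rfl, (h p).beyond.subst _ _, fun r => hmaps p r x₀ (hx₀ (p + 1))⟩
  | tail' a t ht ih =>
    subst ha
    obtain ⟨W, hW, hWt, hWN, hWU⟩ := ih (p + 1) (Stream'.tail_drop' ..).symm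
    exact ⟨W, hW, hWt, hWN.mono (hN p), fun r =>
      (h p).closure_subset (subset_closure (hWU r))⟩
  | cons' a t ht ih =>
    have hhead : a.head = phi y ((w (p + 1)).subst (i (p + 1)) (j (p + 1))) :=
      ha ▸ Stream'.head_drop ..
    rw [hhead]
    subst ha
    obtain ⟨W, hW, rfl, hWN, hWU⟩ := ih (p + 1) (Stream'.tail_drop' ..).symm
    have habs : ∀ t ∈ ((w (p + 1)).subst (i (p + 1)) (j (p + 1))).dom, |t| ≤ (N (p + 1) : ℤ) :=
      (h p).abs_le
    have hphi := phi_concat (y := y) (disjoint_dom_of_beyond habs hWN)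
    refine ⟨_, concat_mem_constWords (hconst p) hW, hphi,
      ((h p).beyond.subst _ _).concat (hWN.mono (hN p)), fun r => ?_⟩
    have hcomp := congrFun (hT r _ (hconst p) W hW (Beyond.R1 habs hWN)) x₀
    rw [hphi] at hcomp
    -- The outer word brings `x₀` into `U (p + 1)`, and the innermost one then maps this set into `U
    -- p`.
    rw [← hcomp]
    exact hmaps p r _ (hWU r)

/-! ### Nested open sets and the limit point. -/

section Recurrence

variable {X H : Type*} [MetricSpace X] [CompactSpace X] [CommGroup H] {ρ : H →* (X ≃ₜ X)}
  {Y : Set X} {m : ℕ} {T : Fin m → S → H}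

theorem IsMinimalClosed.exists_isReturnWord (hY : IsMinimalClosed ρ Y) (hk : IsBounding k)
    (hT : ∀ r, ∀ w₁ ∈ constWords k, ∀ w₂ ∈ constWords k, w₁.R1 w₂ →
      T r (phi y w₁) * T r (phi y w₂) = T r (phi y (w₁.concat w₂)))
    {n : ℕ} (hn : 1 ≤ n) {ε : ℝ} (hε : 0 < ε) (N : ℕ) {U : Set X} (hU : IsOpen U)
    (hUY : (U ∩ Y).Nonempty) :
    ∃ (w : LocatedWord (Option ℤ)) (N' : ℕ) (U' : Set X), (IsOpen U' ∧ (U' ∩ Y).Nonempty) ∧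
      IsReturnWord k y (fun r s => ⇑(ρ (T r s))) n ε N U w N' U' := by
  obtain ⟨F, hF, x, ⟨hxU, hxY⟩, hx⟩ :=
    hY.exists_block (y := y) (N := max N n) hU hUY hk hT hn (le_max_right _ _)
  obtain ⟨N', hN'⟩ := (block (max N n) F hF).exists_abs_le
  have hev : ∀ᶠ z in 𝓝 x, z ∈ U ∧ ∀ r, ∀ i ∈ Finset.Icc 1 (k n), ∀ j ∈ Finset.Icc 1 (k (-n)),
      ρ (T r (phi y ((block (max N n) F hF).subst i j))) z ∈ U := by
    refine Filter.Eventually.and (hU.mem_nhds hxU) ?_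
    rw [Filter.eventually_all]
    intro r
    rw [Filter.eventually_all_finset]
    intro i hi
    rw [Filter.eventually_all_finset]
    intro j hj
    rw [Finset.mem_Icc] at hi hj
    exact (ρ _).continuous.continuousAt.eventually_mem
      (hU.mem_nhds (hx r i j hi.1 hi.2 hj.1 hj.2))
  obtain ⟨δ, hδ, hball⟩ := Metric.eventually_nhds_iff_ball.mp hev
  -- Radius `δ / 2` keeps the closed ball inside the ball of radius `δ`; radius `ε / 2` makes any
  -- two points less than `ε` apart.
  have hr : 0 < min (δ / 2) (ε / 2) := by positivity
  refine ⟨block (max N n) F hF, N', Metric.ball x (min (δ / 2) (ε / 2)),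
    ⟨Metric.isOpen_ball, x, Metric.mem_ball_self hr, hxY⟩,
    hk.block_mem_varWords₀, block_Cneg_nonempty, block_Cpos_nonempty,
    block_beyond.mono (le_max_left _ _), block_beyond.mono (le_max_right _ _), hN', ?_, ?_, ?_⟩
  · intro z hz
    have h := Metric.mem_closedBall.mp (Metric.closure_ball_subset_closedBall hz)
    have := min_le_left (δ / 2) (ε / 2)
    exact (hball z (Metric.mem_ball.mpr (by linarith))).1
  · intro a ha b hb
    rw [Metric.mem_ball] at ha hb
    have := dist_triangle_right a b x
    have := min_le_right (δ / 2) (ε / 2)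
    linarith
  · intro r i j hi hi' hj hj' z hz
    rw [Metric.mem_ball] at hz
    have := min_le_left (δ / 2) (ε / 2)
    exact (hball z (Metric.mem_ball.mpr (by linarith))).2 r i (Finset.mem_Icc.mpr ⟨hi, hi'⟩) j
      (Finset.mem_Icc.mpr ⟨hj, hj'⟩)

theorem IsMinimalClosed.exists_isBlockRecurrentPoint (hY : IsMinimalClosed ρ Y)
    (hk : IsBounding k)
    (hT : ∀ r, ∀ w₁ ∈ constWords k, ∀ w₂ ∈ constWords k, w₁.R1 w₂ →
      T r (phi y w₁) * T r (phi y w₂) = T r (phi y (w₁.concat w₂)))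
    {U : Set X} (hU : IsOpen U) (hUY : (U ∩ Y).Nonempty) :
    ∃ x₀ ∈ U, IsBlockRecurrentPoint k y (fun r s => ⇑(ρ (T r s))) x₀ := by
  have hstep : ∀ (n : ℕ) (q : {q : ℕ × Set X // IsOpen q.2 ∧ (q.2 ∩ Y).Nonempty}),
      ∃ (w : LocatedWord (Option ℤ)) (q' : {q : ℕ × Set X // IsOpen q.2 ∧ (q.2 ∩ Y).Nonempty}),
        IsReturnWord k y (fun r s => ⇑(ρ (T r s))) (n + 1) (1 / ((n : ℝ) + 1)) q.1.1 q.1.2 w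
          q'.1.1 q'.1.2 := fun n q => by
    obtain ⟨w, N', U', hU', h⟩ := hY.exists_isReturnWord hk hT (n := n + 1) (by omega)
      (ε := 1 / ((n : ℝ) + 1)) (by positivity) q.1.1 q.2.1 q.2.2
    exact ⟨w, ⟨(N', U'), hU'⟩, h⟩
  choose W Q hQ using hstep
  let q : ℕ → {q : ℕ × Set X // IsOpen q.2 ∧ (q.2 ∩ Y).Nonempty} := fun n =>
    Nat.rec ⟨(0, U), hU, hUY⟩ (fun n s => Q n s) n
  -- Words are numbered from `1`: `w (p + 1)` leads from stage `p` to stage `p + 1`.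
  let w : ℕ → LocatedWord (Option ℤ) := fun n => W (n - 1) (q (n - 1))
  have h : ∀ p, IsReturnWord k y (fun r s => ⇑(ρ (T r s))) (p + 1) (1 / ((p : ℝ) + 1)) (q p).1.1
      (q p).1.2 (w (p + 1)) (q (p + 1)).1.1 (q (p + 1)).1.2 := fun p => hQ p (q p)
  obtain ⟨x₀, hx₀⟩ := IsCompact.nonempty_iInter_of_sequence_nonempty_isCompact_isClosed
    (fun p => closure (q p).1.2)
    (fun p => (h p).closure_subset.trans subset_closure)
    (fun p => ((q p).2.2.mono Set.inter_subset_left).closure) isClosed_closure.isCompact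
    (fun _ => isClosed_closure)
  have hx₀' : ∀ p, x₀ ∈ (q p).1.2 := fun p =>
    (h p).closure_subset (Set.mem_iInter.mp hx₀ (p + 1))
  refine ⟨x₀, hx₀' 0, w, _, isBlockSequence_of_isReturnWord h, fun r V hV => ?_⟩
  obtain ⟨ε, hε, hball⟩ := Metric.mem_nhds_iff.mp hV
  obtain ⟨p, hp⟩ := exists_nat_one_div_lt hε
  -- Sums starting at index `p + 2` keep `x₀` in `U (p + 1)`, whose points are less than `1 / (p +
  -- 1)` apart.
  refine ⟨p + 2, by omega, fun i j hij t ht => hball ?_⟩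
  obtain ⟨-, -, -, -, hmem⟩ := mem_of_mem_FS hk (fun r w₁ h₁ w₂ h₂ h12 => by
    rw [← hT r w₁ h₁ w₂ h₂ h12, map_mul]; rfl) h hx₀' hij (p + 1) ht
  exact ((h p).dist_lt _ (hmem r) _ (hx₀' (p + 1))).trans hp

end Recurrence

end BlockRecurrence

/-! ### Existence from some minimal set, density from the whole space being minimal. -/

theorem theorem22 {S : Type*} [AddCommSemigroup S] {X : Type*} [MetricSpace X] [CompactSpace X]
    [Nonempty X] (k : ℤ → ℕ) (hk : IsBounding k) (y : ℤ → ℤ → S)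
    (G : Subgroup (X ≃ₜ X)) (hG : ∀ g ∈ G, ∀ h ∈ G, g * h = h * g)
    (m : ℕ) (T : Fin m → S → X ≃ₜ X) (hTG : ∀ r s, T r s ∈ G)
    (hT : ∀ r, IsWordSystem k y (fun s => ⇑(T r s))) :
    (∃ x₀ : X, IsBlockRecurrentPoint k y (fun r s => ⇑(T r s)) x₀) ∧
      (IsMinimalGroup G →
        Dense {x₀ : X | IsBlockRecurrentPoint k y (fun r s => ⇑(T r s)) x₀}) := by
  let _ : CommGroup G := { (inferInstance : Group G) with
    mul_comm := fun g h => Subtype.ext (hG g g.2 h h.2) }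
  let T' : Fin m → S → G := fun r s => ⟨T r s, hTG r s⟩
  have hT' : ∀ r, ∀ w₁ ∈ constWords k, ∀ w₂ ∈ constWords k, w₁.R1 w₂ →
      T' r (phi y w₁) * T' r (phi y w₂) = T' r (phi y (w₁.concat w₂)) :=
    fun r w₁ h₁ w₂ h₂ h => Subtype.ext <| Homeomorph.ext fun x =>
      congrFun ((hT r).comp w₁ h₁ w₂ h₂ h) x
  constructor
  · obtain ⟨Y, hY⟩ := exists_isMinimalClosed G.subtype
    obtain ⟨x₀, -, hx₀⟩ := hY.exists_isBlockRecurrentPoint hk hT' isOpen_univ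
      (by simpa using hY.nonempty)
    exact ⟨x₀, hx₀⟩
  · intro hmin
    have hY : IsMinimalClosed G.subtype (Set.univ : Set X) :=
      ⟨isClosed_univ, Set.univ_nonempty, fun _ _ _ => trivial, fun A _ hA hne hinv =>
        hmin A hA hne fun g hg x hx => hinv ⟨g, hg⟩ x hx⟩
    refine dense_iff_inter_open.mpr fun U hU hne => ?_
    exact hY.exists_isBlockRecurrentPoint hk hT' hU (by simpa using hne)
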